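/- Let $\mathbb{N}=\{1,2,3,\dots\}$. For a finite poset $P$, define the formal power series \[ \Gamma^{<}(P,\boldsymbol{x})=\sum_{f}\prod_{v\in P}x_{f(v)},\qquad \Gamma^{\le}(P,\boldsymbol{x})=\sum_{g}\prod_{v\in P}x_{g(v)} \] in $\mathbb{Z}[[x_1,x_2,\dots]]$, where $f$ runs over all maps $P\to\mathbb{N}$ such that $u<v$ implies $f(u)<f(v)$, and $g$ runs over all maps $P\to\mathbb{N}$ such that $u<v$ implies $g(u)\le g(v)$. Let $\mathsf{N}$ be the poset on four elements $a,b,c,d$ whose only strict relations are $a<b$, $c<b$, $c<d$, and let $\Join$ be the poset on $a,b,c,d$ whose only strict relations are $a<b$, $c<b$, $c<d$, $a<d$. A poset is $(\mathsf{N},\Join)$-free if no subset of it, with the induced order, is isomorphic to $\mathsf{N}$ or to $\Join$. Theorem. Let $P$ and $Q$ be finite $(\mathsf{N},\Join)$-free posets. Then the following are equivalent: (1) $\Gamma^{<}(P,\boldsymbol{x})=\Gamma^{<}(Q,\boldsymbol{x})$; (2) $\Gamma^{\le}(P,\boldsymbol{x})=\Gamma^{\le}(Q,\boldsymbol{x})$;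 (3) $P$ and $Q$ are isomorphic as posets. -/

import Mathlib

/-- The four-element poset `N`, with the strict relations `a < b`, `c < b`, `c < d` and no
others. -/
inductive PosetN : Type
  | a
  | b
  | c
  | d
  deriving DecidableEq

/-- The four-element poset `⋈`, with the strict relations `a < b`, `c < b`, `c < d`, `a < d` and
no others. -/
inductive PosetBowtie : Type
  | a
  | b
  | c
  | d
  deriving DecidableEq

instance : PartialOrder PosetN where
  le x y := x = y ∨ (x = .a ∧ y = .b) ∨ (x = .c ∧ y = .b) ∨ (x = .c ∧ y = .d)
  le_refl x := Or.inl rfl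
  le_trans x y z := by cases x <;> cases y <;> cases z <;> decide
  le_antisymm x y := by cases x <;> cases y <;> decide

instance : PartialOrder PosetBowtie where
  le x y := x = y ∨ (x = .a ∧ y = .b) ∨ (x = .c ∧ y = .b) ∨ (x = .c ∧ y = .d) ∨
    (x = .a ∧ y = .d)
  le_refl x := Or.inl rfl
  le_trans x y z := by cases x <;> cases y <;> cases z <;> decide
  le_antisymm x y := by cases x <;> cases y <;> decide

/-- A poset is `(N, ⋈)`-free if no subset with the induced order is isomorphic to `N` or to `⋈`,
that is, neither `N` nor `⋈` has an order embedding (`x ≤ y ↔ f x ≤ f y`) into it. -/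
def IsNBowtieFree (P : Type*) [PartialOrder P] : Prop :=
  IsEmpty (PosetN ↪o P) ∧ IsEmpty (PosetBowtie ↪o P)

/-- Only finitely many maps `f : P → {1, 2, …}` contribute to a given monomial `x ^ m`. -/
theorem finite_support_coeff_prod_X (P : Type*) [Fintype P] (m : ℕ+ →₀ ℕ) :
    (Function.support fun f : P → ℕ+ =>
      MvPowerSeries.coeff m (∏ v, MvPowerSeries.X (f v) : MvPowerSeries ℕ+ ℤ)).Finite := by
  classical
  refine (Set.Finite.pi' (fun _ : P => m.support.finite_toSet)).subset fun f hf v => ?_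
  have h : (∏ v, MvPowerSeries.X (f v) : MvPowerSeries ℕ+ ℤ) =
      ((MvPolynomial.monomial (∑ v, Finsupp.single (f v) 1) (1 : ℤ) : MvPolynomial ℕ+ ℤ) :
        MvPowerSeries ℕ+ ℤ) := by
    rw [MvPolynomial.monomial_sum_one, ← MvPolynomial.coeToMvPowerSeries.ringHom_apply, map_prod]
    refine Finset.prod_congr rfl fun v _ => ?_
    rw [MvPolynomial.coeToMvPowerSeries.ringHom_apply, MvPolynomial.coe_monomial, MvPowerSeries.X]
  rw [Function.mem_support, h, MvPolynomial.coeff_coe, MvPolynomial.coeff_monomial] at hf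
  have hm : ∑ v, Finsupp.single (f v) 1 = m := by
    by_contra hne
    exact hf (if_neg hne)
  rw [Finset.mem_coe, Finsupp.mem_support_iff, ← hm, Finsupp.finsetSum_apply]
  intro h0
  have := (Finset.sum_eq_zero_iff.mp h0) v (Finset.mem_univ v)
  simp at this

/-- The formal power series `∑_{f ∈ S} ∏_{v ∈ P} x_{f(v)}` in the variables `x₁, x₂, …`, where `S`
is a set of maps from `P` to the positive integers. The formal sum is taken coefficientwise; by
`finite_support_coeff_prod_X` every coefficient is a sum with finitely many non-zero terms. -/
noncomputable def formalSum {P : Type*} [Fintype P] (S : Set (P → ℕ+)) : MvPowerSeries ℕ+ ℤ :=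
  fun m => ∑ᶠ f ∈ S, MvPowerSeries.coeff m (∏ v, MvPowerSeries.X (f v) : MvPowerSeries ℕ+ ℤ)

/-- The strict order quasisymmetric function `Γ^<(P, x)`: the sum is over the maps `f` such that
`u < v` implies `f u < f v`. -/
noncomputable def strictOrderQSym (P : Type*) [Fintype P] [PartialOrder P] :
    MvPowerSeries ℕ+ ℤ :=
  formalSum {f : P → ℕ+ | ∀ u v, u < v → f u < f v}

/-- The weak order quasisymmetric function `Γ^≤(P, x)`: the sum is over the maps `f` such that
`u < v` implies `f u ≤ f v`. -/
noncomputable def weakOrderQSym (P : Type*) [Fintype P] [PartialOrder P] :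
    MvPowerSeries ℕ+ ℤ :=
  formalSum {f : P → ℕ+ | ∀ u v, u < v → f u ≤ f v}

/-!
From (2) to (1): let some labels be strict (used on antichains only) and the others weak. Replacing
a strict label `a` by `a` and a weak label `b` directly above it, the labellings counted with sign
`(-1) ^ #(label a)` cancel in pairs, by toggling one minimal element between `a` and `b`. Hence the
counts with strict labels are determined by the weak ones. Room for the extra labels is made by
passing from `ℕ+` to `ℝ`.

From (1) to (3): a connected finite `(N, ⋈)`-free poset has a least or a greatest element, since the
zigzags between its minimal and its maximal elements are degenerate. In sufficiently many variables
the polynomial of a disjoint union is the product of the polynomials of the summands, and that of a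
poset with a least element is irreducible: in the first variable it is linear, with coefficients the
polynomials of `P ∖ {0̂}` and of `P`, which are coprime by induction. Unique factorization
recovers the polynomials of the connected components; being linear in the first variable
characterizes the presence of a least element, whose removal is read off the leading coefficient.
-/

section Labelling

variable {P Q Λ Λ' : Type*}

/-- `f : P → Λ` is an order-preserving labelling which is strict on the labels in `t`: the labels
in `t` are used by antichains only. For `t = univ` and `t = ∅` these are the labellings summed over
in `strictOrderQSym P` and `weakOrderQSym P`. -/
def IsAdmissible [Preorder P] [Preorder Λ] (t : Set Λ) (f : P → Λ) : Prop :=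
  ∀ u v, u < v → f u < f v ∨ f u = f v ∧ f u ∉ t

/-- The content of a labelling `f`, i.e. the exponent vector of the monomial `∏ v, x_{f v}`. -/
noncomputable def content [Fintype P] (f : P → Λ) : Λ →₀ ℕ :=
  ∑ v, Finsupp.single (f v) 1

/-- The coefficient of `x ^ d` in the generating function of the labellings of `P` that are
admissible for `t`. -/
noncomputable def admissibleCount (P : Type*) [Fintype P] [Preorder P] [Preorder Λ] (t : Set Λ)
    (d : Λ →₀ ℕ) : ℕ :=
  {f : P → Λ | IsAdmissible t f ∧ content f = d}.ncard

theorem isAdmissible_empty_iff [Preorder P] [PartialOrder Λ] {f : P → Λ} :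
    IsAdmissible ∅ f ↔ ∀ u v, u < v → f u ≤ f v := by
  simp [IsAdmissible, le_iff_lt_or_eq]

theorem isAdmissible_univ_iff [Preorder P] [Preorder Λ] {f : P → Λ} :
    IsAdmissible Set.univ f ↔ StrictMono f := by
  simp [IsAdmissible, StrictMono]

theorem isAdmissible_orderEmbedding_comp_iff [Preorder P] [PartialOrder Λ] [PartialOrder Λ']
    (e : Λ ↪o Λ') {t : Set Λ'} {f : P → Λ} :
    IsAdmissible t (e ∘ f) ↔ IsAdmissible (e ⁻¹' t) f := by
  simp [IsAdmissible]

theorem isAdmissible_comp_orderIso_iff [Preorder P] [Preorder Q] [Preorder Λ] (e : P ≃o Q)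
    {t : Set Λ} {f : Q → Λ} : IsAdmissible t (f ∘ e) ↔ IsAdmissible t f := by
  refine ⟨fun h u v huv => ?_, fun h u v huv => h _ _ (e.strictMono huv)⟩
  simpa using h (e.symm u) (e.symm v) (e.symm.strictMono huv)

section Content

variable [Fintype P] [Fintype Q]

theorem content_apply_ne_zero {f : P → Λ} {a : Λ} : content f a ≠ 0 ↔ ∃ v, f v = a := by
  classical
  simp [content, Finsupp.finsetSum_apply, Finsupp.single_apply]

theorem content_comp (φ : Λ → Λ') (f : P → Λ) :
    content (φ ∘ f) = (content f).mapDomain φ := by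
  simp [content, Finsupp.mapDomain_finsetSum, Finsupp.mapDomain_single]

theorem content_comp_equiv (e : P ≃ Q) (f : Q → Λ) : content (f ∘ e) = content f :=
  e.sum_comp fun v => Finsupp.single (f v) 1

theorem content_update_add_single [DecidableEq P] (f : P → Λ) (v : P) (a : Λ) :
    content (Function.update f v a) + Finsupp.single (f v) 1 = content f + Finsupp.single a 1 := by
  have hne : ∀ w ∈ Finset.univ.erase v,
      Finsupp.single (Function.update f v a w) 1 = Finsupp.single (f w) 1 := fun w hw => by
    rw [Function.update_of_ne (Finset.ne_of_mem_erase hw)]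
  rw [content, content, ← Finset.sum_erase_add _ _ (Finset.mem_univ v),
    ← Finset.sum_erase_add _ _ (Finset.mem_univ v), Finset.sum_congr rfl hne,
    Function.update_self, add_right_comm]

theorem finite_setOf_content_eq (d : Λ →₀ ℕ) : {f : P → Λ | content f = d}.Finite :=
  (Set.Finite.pi' fun _ : P => d.support.finite_toSet).subset fun f hf v => by
    rw [Finset.mem_coe, Finsupp.mem_support_iff, ← show content f = d from hf]
    exact content_apply_ne_zero.2 ⟨v, rfl⟩

theorem prod_X_eq_monomial_content {R : Type*} [CommSemiring R] (f : P → Λ) :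
    ∏ v, MvPolynomial.X (f v) = MvPolynomial.monomial (content f) (1 : R) :=
  (MvPolynomial.monomial_sum_one _ _).symm

end Content

section Count

variable [Fintype P] [PartialOrder P] [Fintype Q] [PartialOrder Q]

theorem admissibleCount_congr [Preorder Λ] (e : P ≃o Q) (t : Set Λ) (d : Λ →₀ ℕ) :
    admissibleCount P t d = admissibleCount Q t d := by
  rw [admissibleCount, admissibleCount, ← Set.ncard_preimage_of_injective_subset_range
    (f := fun f : Q → Λ => f ∘ e) (e.surjective.injective_comp_right)
    fun f _ => ⟨f ∘ e.symm, by ext; simp⟩]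
  congr! 2
  ext f
  exact and_congr (isAdmissible_comp_orderIso_iff e)
    (by rw [content_comp_equiv e.toEquiv f |>.symm]; rfl)

theorem admissibleCount_mapDomain [PartialOrder Λ] [PartialOrder Λ'] (e : Λ ↪o Λ') (t : Set Λ')
    (d : Λ →₀ ℕ) : admissibleCount P t (d.mapDomain e) = admissibleCount P (e ⁻¹' t) d := by
  have himage : {f : P → Λ' | IsAdmissible t f ∧ content f = d.mapDomain e} =
      (e ∘ ·) '' {f : P → Λ | IsAdmissible (e ⁻¹' t) f ∧ content f = d} := by
    ext f
    constructor
    · rintro ⟨hf, hc⟩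
      have hrange (v : P) : ∃ a, e a = f v := by
        have hv : (d.mapDomain e) (f v) ≠ 0 := hc ▸ content_apply_ne_zero.2 ⟨v, rfl⟩
        by_contra hv'
        exact hv (Finsupp.mapDomain_of_notMem_range _ _ hv')
      choose g hg using hrange
      obtain rfl : e ∘ g = f := funext hg
      rw [content_comp] at hc
      exact ⟨g, ⟨(isAdmissible_orderEmbedding_comp_iff e).1 hf,
        Finsupp.mapDomain_injective e.injective hc⟩, rfl⟩
    · rintro ⟨g, ⟨hg, rfl⟩, rfl⟩
      exact ⟨(isAdmissible_orderEmbedding_comp_iff e).2 hg, content_comp _ _⟩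
  rw [admissibleCount, himage, Set.ncard_image_of_injective _ e.injective.comp_left,
    admissibleCount]

theorem admissibleCount_eq_of_disjoint [PartialOrder Λ] {t : Set Λ} {d : Λ →₀ ℕ}
    (h : ∀ a ∈ d.support, a ∉ t) : admissibleCount P t d = admissibleCount P ∅ d := by
  rw [admissibleCount, admissibleCount]
  congr 1
  ext f
  refine and_congr_left fun hf => forall₂_congr fun u v => ?_
  have hu : f u ∉ t :=
    h _ (Finsupp.mem_support_iff.2 (hf ▸ content_apply_ne_zero.2 ⟨u, rfl⟩))
  simp [hu]

theorem admissibleCount_empty_eq_of_infinite [LinearOrder Λ] [Infinite Λ] [LinearOrder Λ']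
    (h : ∀ d : Λ →₀ ℕ, admissibleCount P ∅ d = admissibleCount Q ∅ d) (d : Λ' →₀ ℕ) :
    admissibleCount P ∅ d = admissibleCount Q ∅ d := by
  obtain ⟨s, hs⟩ := Infinite.exists_subset_card_eq Λ d.support.card
  let e : Fin d.support.card ↪o Λ' := d.support.orderEmbOfFin rfl
  obtain ⟨c, hc⟩ : ∃ c, c.mapDomain e = d :=
    ⟨d.comapDomain e e.injective.injOn,
      Finsupp.mapDomain_comapDomain e e.injective d (by simp [e])⟩
  have hPQ := h (c.mapDomain (s.orderEmbOfFin hs))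
  rw [admissibleCount_mapDomain, admissibleCount_mapDomain, Set.preimage_empty] at hPQ
  rwa [← hc, admissibleCount_mapDomain, admissibleCount_mapDomain, Set.preimage_empty]

end Count

end Labelling

section OrderQSym

variable {P : Type*} [Fintype P]

theorem coeff_formalSum (S : Set (P → ℕ+)) (d : ℕ+ →₀ ℕ) :
    MvPowerSeries.coeff d (formalSum S) = {f ∈ S | content f = d}.ncard := by
  classical
  have hprod (f : P → ℕ+) :
      MvPowerSeries.coeff d (∏ v, MvPowerSeries.X (f v) : MvPowerSeries ℕ+ ℤ) =
        if content f = d then 1 else 0 := by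
    have hcoe : (∏ v, MvPowerSeries.X (f v) : MvPowerSeries ℕ+ ℤ) =
        (MvPolynomial.monomial (content f) (1 : ℤ) : MvPolynomial ℕ+ ℤ) := by
      rw [← prod_X_eq_monomial_content, ← MvPolynomial.coeToMvPowerSeries.ringHom_apply, map_prod]
      simp
    rw [hcoe, MvPolynomial.coeff_coe, MvPolynomial.coeff_monomial]
  have hfin : {f ∈ S | content f = d}.Finite :=
    (finite_setOf_content_eq d).subset fun f hf => hf.2
  calc MvPowerSeries.coeff d (formalSum S)
      = ∑ᶠ f ∈ S, if content f = d then (1 : ℤ) else 0 := by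
        simp only [← hprod]; rfl
    _ = ∑ᶠ f ∈ {f ∈ S | content f = d}, (1 : ℤ) := by
        refine finsum_congr fun f => ?_
        by_cases hS : f ∈ S <;> by_cases hd : content f = d <;> simp [hS, hd]
    _ = {f ∈ S | content f = d}.ncard := by
        rw [finsum_mem_eq_finite_toFinset_sum _ hfin, Set.ncard_eq_toFinset_card _ hfin]
        simp

variable [PartialOrder P]

theorem coeff_strictOrderQSym (d : ℕ+ →₀ ℕ) :
    MvPowerSeries.coeff d (strictOrderQSym P) = admissibleCount P Set.univ d := by
  simp [strictOrderQSym, coeff_formalSum, admissibleCount, IsAdmissible]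

theorem coeff_weakOrderQSym (d : ℕ+ →₀ ℕ) :
    MvPowerSeries.coeff d (weakOrderQSym P) = admissibleCount P ∅ d := by
  simp [weakOrderQSym, coeff_formalSum, admissibleCount, isAdmissible_empty_iff]

end OrderQSym

section WeakToStrict

open Finset.HasAntidiagonal (antidiagonal mem_antidiagonal)

variable {P Q Λ : Type*}

/-- The map of labels identifying `b` with `a`. -/
def mergeLabel [DecidableEq Λ] (a b q : Λ) : Λ := if q = b then a else q

theorem mapDomain_mergeLabel_eq_iff [DecidableEq Λ] {a b : Λ} (hab : a ≠ b) {d e : Λ →₀ ℕ}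
    (ha : d a = 0) (hb : d b = 0) {n : ℕ} :
    e.mapDomain (mergeLabel a b) = d + Finsupp.single a n ↔
      ∃ p ∈ antidiagonal n, e = d + Finsupp.single a p.1 + Finsupp.single b p.2 := by
  have hmap (c : Λ →₀ ℕ) (hc : c b = 0) (i j : ℕ) :
      (c + Finsupp.single a i + Finsupp.single b j).mapDomain (mergeLabel a b) =
        c + Finsupp.single a (i + j) := by
    have hc' : c.mapDomain (mergeLabel a b) = c.mapDomain id :=
      Finsupp.mapDomain_congr fun x hx =>
        if_neg fun hxb : x = b => (Finsupp.mem_support_iff.1 hx) (hxb ▸ hc)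
    simp [Finsupp.mapDomain_add, Finsupp.mapDomain_single, hc', mergeLabel, hab, add_assoc]
  constructor
  · intro h
    let c := (e.erase a).erase b
    have he : e = c + Finsupp.single a (e a) + Finsupp.single b (e b) := by
      ext x
      rcases eq_or_ne x a with rfl | hxa
      · simp [c, hab]
      · rcases eq_or_ne x b with rfl | hxb <;> simp [c, *]
    rw [he, hmap c (by simp [c])] at h
    have hn : e a + e b = n := by simpa [c, ha, hab] using DFunLike.congr_fun h a
    rw [hn, add_left_inj] at h
    exact ⟨(e a, e b), mem_antidiagonal.2 hn, h ▸ he⟩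
  · rintro ⟨p, hp, rfl⟩
    rw [hmap d hb, mem_antidiagonal.1 hp]

theorem IsAdmissible.update [DecidableEq P] [PartialOrder P] [LinearOrder Λ] {t : Set Λ}
    {f : P → Λ} (hf : IsAdmissible t f) {a b : Λ} (hab : a < b) (ha : a ∈ t) (hb : b ∉ t)
    (hgap : ∀ v, f v ≤ a ∨ b ≤ f v) {v₀ : P} (hv₀ : f v₀ = a ∨ f v₀ = b)
    (hmin : ∀ v < v₀, f v ≠ a ∧ f v ≠ b) {c : Λ} (hc : c = a ∨ c = b) :
    IsAdmissible t (Function.update f v₀ c) := by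
  intro u v huv
  have huv' := hf u v huv
  rcases eq_or_ne u v₀ with rfl | hu
  · rw [Function.update_self, Function.update_of_ne huv.ne']
    have hne : f v ≠ a := by grind
    have hbv : b ≤ f v := by grind
    rcases hbv.lt_or_eq with h | rfl <;> grind
  rcases eq_or_ne v v₀ with rfl | hv
  · rw [Function.update_self, Function.update_of_ne hu]
    have hu' := hmin u huv
    grind
  · rwa [Function.update_of_ne hu, Function.update_of_ne hv]

theorem neg_one_pow_content_update_swap [Fintype P] [DecidableEq P] [DecidableEq Λ] {f : P → Λ}
    {a b : Λ} (hab : a ≠ b) {v : P} (hv : f v = a ∨ f v = b) :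
    (-1 : ℤ) ^ content f a +
      (-1) ^ content (Function.update f v (Equiv.swap a b (f v))) a = 0 := by
  have h := DFunLike.congr_fun (content_update_add_single f v (Equiv.swap a b (f v))) a
  rcases hv with hv | hv
  · simp only [hv, Equiv.swap_apply_left, Finsupp.add_apply, Finsupp.single_eq_same,
      Finsupp.single_eq_of_ne hab, add_zero] at h ⊢
    rw [← h, pow_succ]
    ring
  · simp only [hv, Equiv.swap_apply_right, Finsupp.add_apply, Finsupp.single_eq_same,
      Finsupp.single_eq_of_ne hab, add_zero] at h ⊢
    rw [h, pow_succ]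
    ring

/-- The toggle exchanges the labels `a` and `b` at a fixed minimal element of the fibre `g⁻¹ a`. -/
theorem sum_neg_one_pow_content_fiber_eq_zero [Fintype P] [PartialOrder P] [LinearOrder Λ]
    {t : Set Λ} {a b : Λ} (hab : a < b) (ha : a ∈ t) (hb : b ∉ t) {g : P → Λ}
    (hgap : ∀ v, g v ≤ a ∨ b < g v) (hga : ∃ v, g v = a) {F : Finset (P → Λ)}
    (hF : ∀ f, f ∈ F ↔ IsAdmissible t f ∧ mergeLabel a b ∘ f = g) :
    ∑ f ∈ F, (-1 : ℤ) ^ content f a = 0 := by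
  classical
  obtain ⟨v₀, hv₀⟩ := (Set.toFinite {v | g v = a}).exists_minimal hga
  have hlabel {f : P → Λ} (hf : f ∈ F) (v : P) : (if f v = b then a else f v) = g v :=
    congrFun ((hF f).1 hf).2 v
  have hmem {f : P → Λ} (hf : f ∈ F) : f v₀ = a ∨ f v₀ = b := by
    have := hlabel hf v₀
    have := hv₀.prop
    grind
  have hswap {f : P → Λ} (hf : f ∈ F) :
      Equiv.swap a b (f v₀) = a ∨ Equiv.swap a b (f v₀) = b := by
    rcases hmem hf with h | h <;> simp [h]
  refine Finset.sum_involution (fun f _ => Function.update f v₀ (Equiv.swap a b (f v₀)))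
    (fun f hf => neg_one_pow_content_update_swap hab.ne (hmem hf)) (fun f hf _ heq => ?_)
    (fun f hf => (hF _).2 ⟨?_, ?_⟩) (fun f _ => by simp)
  · have := congrFun heq v₀
    rcases hmem hf with h | h <;> simp [h, hab.ne, hab.ne'] at this
  · refine ((hF f).1 hf).1.update hab ha hb (fun v => ?_) (hmem hf) (fun v hv => ?_) (hswap hf)
    · have := hgap v
      have := hlabel hf v
      grind
    · have : g v ≠ a := fun h => hv₀.not_prop_of_lt hv h
      have := hlabel hf v
      grind
  · rw [Function.comp_update, ((hF f).1 hf).2, Function.update_eq_self_iff]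
    rcases hswap hf with h | h <;> simp [h, mergeLabel, show g v₀ = a from hv₀.prop]

theorem sum_neg_one_pow_content_eq_zero [Fintype P] [PartialOrder P] [LinearOrder Λ] {t : Set Λ}
    {a b : Λ} (hab : a < b) (ha : a ∈ t) (hb : b ∉ t) {d : Λ →₀ ℕ} (hd : d a = 0)
    (hgap : ∀ c ∈ d.support, c ≤ a ∨ b < c) {n : ℕ} (hn : n ≠ 0) {F : Finset (P → Λ)}
    (hF : ∀ f, f ∈ F ↔
      IsAdmissible t f ∧ content (mergeLabel a b ∘ f) = d + Finsupp.single a n) :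
    ∑ f ∈ F, (-1 : ℤ) ^ content f a = 0 := by
  classical
  rw [← Finset.sum_fiberwise_of_maps_to
    (fun f hf => Finset.mem_image_of_mem (mergeLabel a b ∘ ·) hf)]
  refine Finset.sum_eq_zero fun g hg => ?_
  obtain ⟨f₀, hf₀, rfl⟩ := Finset.mem_image.1 hg
  have hcontent := ((hF f₀).1 hf₀).2
  refine sum_neg_one_pow_content_fiber_eq_zero hab ha hb (g := mergeLabel a b ∘ f₀)
    (fun v => ?_) ?_ fun f => ?_
  · have hv : content (mergeLabel a b ∘ f₀) (mergeLabel a b (f₀ v)) ≠ 0 :=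
      content_apply_ne_zero.2 ⟨v, rfl⟩
    rcases eq_or_ne (mergeLabel a b (f₀ v)) a with h | h
    · exact Or.inl h.le
    · rw [hcontent, Finsupp.add_apply, Finsupp.single_eq_of_ne h, add_zero] at hv
      exact hgap _ (Finsupp.mem_support_iff.2 hv)
  · rw [← content_apply_ne_zero, hcontent]
    simpa [hd] using hn
  · rw [Finset.mem_filter, hF]
    exact and_congr_left fun h => and_iff_left (h ▸ hcontent)

theorem sum_antidiagonal_neg_one_pow_mul_admissibleCount [Fintype P] [PartialOrder P]
    [LinearOrder Λ] {t : Set Λ} {a b : Λ} (hab : a < b) (ha : a ∈ t) (hb : b ∉ t) {d : Λ →₀ ℕ}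
    (hd : d a = 0) (hgap : ∀ c ∈ d.support, c ≤ a ∨ b < c) {n : ℕ} (hn : n ≠ 0) :
    ∑ p ∈ antidiagonal n, (-1 : ℤ) ^ p.1 *
      admissibleCount P t (d + Finsupp.single a p.1 + Finsupp.single b p.2) = 0 := by
  classical
  have hdb : d b = 0 := by
    by_contra h
    exact (hgap b (Finsupp.mem_support_iff.2 h)).elim hab.not_ge (lt_irrefl b)
  let e (p : ℕ × ℕ) : Λ →₀ ℕ := d + Finsupp.single a p.1 + Finsupp.single b p.2
  have he_a (p : ℕ × ℕ) : e p a = p.1 := by simp [e, hd, hab.ne]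
  have he_b (p : ℕ × ℕ) : e p b = p.2 := by simp [e, hdb, hab.ne']
  have hfin (p : ℕ × ℕ) : {f : P → Λ | IsAdmissible t f ∧ content f = e p}.Finite :=
    (finite_setOf_content_eq (e p)).subset fun f hf => hf.2
  calc ∑ p ∈ antidiagonal n, (-1 : ℤ) ^ p.1 * admissibleCount P t (e p)
      = ∑ p ∈ antidiagonal n, ∑ f ∈ (hfin p).toFinset, (-1 : ℤ) ^ content f a := by
        refine Finset.sum_congr rfl fun p _ => ?_
        rw [admissibleCount, Set.ncard_eq_toFinset_card _ (hfin p), mul_comm, ← nsmul_eq_mul]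
        refine (Finset.sum_eq_card_nsmul fun f hf => ?_).symm
        rw [((hfin p).mem_toFinset.1 hf).2, he_a]
    _ = ∑ f ∈ (antidiagonal n).biUnion fun p => (hfin p).toFinset, (-1 : ℤ) ^ content f a := by
        refine (Finset.sum_biUnion fun p _ q _ hpq =>
          Finset.disjoint_left.2 fun f hp hq => hpq ?_).symm
        have h : e p = e q := by
          rw [← ((hfin p).mem_toFinset.1 hp).2, ← ((hfin q).mem_toFinset.1 hq).2]
        exact Prod.ext (by rw [← he_a, h, he_a]) (by rw [← he_b, h, he_b])
    _ = 0 := sum_neg_one_pow_content_eq_zero hab ha hb hd hgap hn fun f => by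
        rw [content_comp, mapDomain_mergeLabel_eq_iff hab.ne hd hdb]
        simp only [Finset.mem_biUnion, Set.Finite.mem_toFinset, Set.mem_ofPred_eq, e,
          and_left_comm (b := IsAdmissible t f), exists_and_left]

theorem exists_gt_notMem_forall_mem [LinearOrder Λ] [NoMaxOrder Λ] {t : Set Λ}
    (ht : ∀ a b, a < b → ∃ c ∉ t, a < c ∧ c < b) (s : Finset Λ) (a : Λ) :
    ∃ b > a, b ∉ t ∧ ∀ x ∈ s, x ≤ a ∨ b < x := by
  obtain ⟨m, hm⟩ := exists_gt a
  obtain ⟨c, hc, hmin⟩ := (insert m (s.filter (a < ·))).exists_min_image id ⟨m, by simp⟩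
  obtain ⟨b, hbt, hab, hbc⟩ := ht a c (by
    rcases Finset.mem_insert.1 hc with rfl | hc
    exacts [hm, (Finset.mem_filter.1 hc).2])
  refine ⟨b, hab, hbt, fun x hx => or_iff_not_imp_left.2 fun hxa => hbc.trans_le ?_⟩
  exact hmin x (Finset.mem_insert_of_mem (Finset.mem_filter.2 ⟨hx, not_le.1 hxa⟩))

/-- The alternating sum over the ways of splitting the strict label `a` into `a` and a weak label
`b` next to it determines the term with no `b` from those with fewer `a`. -/
theorem admissibleCount_add_single_eq_of_forall_lt [Fintype P] [PartialOrder P] [Fintype Q]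
    [PartialOrder Q] [LinearOrder Λ] {t : Set Λ} {a b : Λ} (hab : a < b) (ha : a ∈ t) (hb : b ∉ t)
    {d : Λ →₀ ℕ} (hd : d a = 0) (hgap : ∀ c ∈ d.support, c ≤ a ∨ b < c) {n : ℕ} (hn : n ≠ 0)
    (h : ∀ i < n, ∀ j, admissibleCount P t (d + Finsupp.single a i + Finsupp.single b j) =
      admissibleCount Q t (d + Finsupp.single a i + Finsupp.single b j)) :
    admissibleCount P t (d + Finsupp.single a n) =
      admissibleCount Q t (d + Finsupp.single a n) := by
  have hdiff := (sum_antidiagonal_neg_one_pow_mul_admissibleCount (P := P) hab ha hb hd hgap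
    hn).trans (sum_antidiagonal_neg_one_pow_mul_admissibleCount (P := Q) hab ha hb hd hgap hn).symm
  rw [← sub_eq_zero, ← Finset.sum_sub_distrib,
    Finset.sum_eq_single_of_mem (n, 0) (mem_antidiagonal.2 (add_zero _))] at hdiff
  · rw [← mul_sub, mul_eq_zero_iff_left (pow_ne_zero _ (by decide)), sub_eq_zero] at hdiff
    simpa only [Finsupp.single_zero, add_zero] using Int.natCast_inj.1 hdiff
  · intro p hp hpn
    have hlt : p.1 < n := by
      have := mem_antidiagonal.1 hp
      grind
    rw [h _ hlt, sub_self]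

theorem admissibleCount_eq_of_admissibleCount_empty_eq [Fintype P] [PartialOrder P] [Fintype Q]
    [PartialOrder Q] [LinearOrder Λ] [NoMaxOrder Λ] {t : Set Λ}
    (ht : ∀ a b, a < b → ∃ c ∉ t, a < c ∧ c < b)
    (h : ∀ d : Λ →₀ ℕ, admissibleCount P ∅ d = admissibleCount Q ∅ d) (d : Λ →₀ ℕ) :
    admissibleCount P t d = admissibleCount Q t d := by
  classical
  induction hk : (d.filter (· ∈ t)).degree using Nat.strong_induction_on generalizing d with
  | _ k ih =>
  by_cases hdt : ∀ a ∈ d.support, a ∉ t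
  · rw [admissibleCount_eq_of_disjoint hdt, admissibleCount_eq_of_disjoint hdt, h]
  push Not at hdt
  obtain ⟨a, had, hat⟩ := hdt
  obtain ⟨b, hab, hbt, hgap⟩ := exists_gt_notMem_forall_mem ht d.support a
  have hgap' : ∀ c ∈ (d.erase a).support, c ≤ a ∨ b < c := fun c hc =>
    hgap c (Finset.mem_of_mem_erase (Finsupp.support_erase (f := d) ▸ hc))
  have hdegree (i j : ℕ) :
      ((d.erase a + Finsupp.single a i + Finsupp.single b j).filter (· ∈ t)).degree =
        ((d.erase a).filter (· ∈ t)).degree + i := by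
    simp [Finsupp.filter_add, Finsupp.filter_single_of_pos (· ∈ t) hat,
      Finsupp.filter_single_of_neg (· ∈ t) hbt]
  have hd : ((d.erase a).filter (· ∈ t)).degree + d a = k := by
    simpa [Finsupp.erase_add_single, hk] using (hdegree (d a) 0).symm
  rw [← Finsupp.erase_add_single a d]
  refine admissibleCount_add_single_eq_of_forall_lt hab hat hbt Finsupp.erase_same hgap'
    (Finsupp.mem_support_iff.1 had) fun i hi j => ih _ ?_ _ rfl
  rw [hdegree]
  lia

theorem strictOrderQSym_eq_of_weakOrderQSym_eq [Fintype P] [PartialOrder P] [Fintype Q]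
    [PartialOrder Q] (h : weakOrderQSym P = weakOrderQSym Q) :
    strictOrderQSym P = strictOrderQSym Q := by
  let e : ℕ+ ↪o ℝ := OrderEmbedding.ofStrictMono (fun n => ((n : ℕ) : ℝ)) fun a b hab =>
    Nat.cast_lt.2 (PNat.coe_lt_coe a b |>.2 hab)
  have hdense : Dense (Set.range e)ᶜ := (Set.countable_range e).dense_compl ℝ
  have hweak (d : ℕ+ →₀ ℕ) : admissibleCount P ∅ d = admissibleCount Q ∅ d := by
    have := congrArg (MvPowerSeries.coeff d) h
    rwa [coeff_weakOrderQSym, coeff_weakOrderQSym, Int.natCast_inj] at this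
  ext d
  rw [coeff_strictOrderQSym, coeff_strictOrderQSym, ← Set.preimage_range e,
    ← admissibleCount_mapDomain, ← admissibleCount_mapDomain,
    admissibleCount_eq_of_admissibleCount_empty_eq (fun a b => hdense.exists_between)
      (admissibleCount_empty_eq_of_infinite hweak)]

end WeakToStrict

section Structure

theorem PosetN.le_iff (x y : PosetN) : x ≤ y ↔
    x = y ∨ (x = .a ∧ y = .b) ∨ (x = .c ∧ y = .b) ∨ (x = .c ∧ y = .d) := Iff.rfl

theorem PosetBowtie.le_iff (x y : PosetBowtie) : x ≤ y ↔
    x = y ∨ (x = .a ∧ y = .b) ∨ (x = .c ∧ y = .b) ∨ (x = .c ∧ y = .d) ∨ (x = .a ∧ y = .d) :=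
  Iff.rfl

/-- The reversal `a ↔ d`, `b ↔ c` of the path `a < b > c < d`, which shows that `N` is
self-dual. -/
def PosetN.toDual : PosetN ↪o PosetNᵒᵈ :=
  OrderEmbedding.ofMapLEIff
    (fun x => OrderDual.toDual (match x with | .a => .d | .b => .c | .c => .b | .d => .a))
    (by intro x y; cases x <;> cases y <;> simp [PosetN.le_iff])

/-- The exchange `a ↔ d`, `b ↔ c` of minimal and maximal elements, which shows that `⋈` is
self-dual. -/
def PosetBowtie.toDual : PosetBowtie ↪o PosetBowtieᵒᵈ :=
  OrderEmbedding.ofMapLEIff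
    (fun x => OrderDual.toDual (match x with | .a => .d | .b => .c | .c => .b | .d => .a))
    (by intro x y; cases x <;> cases y <;> simp [PosetBowtie.le_iff])

variable {P : Type*} [PartialOrder P]

theorem IsNBowtieFree.of_orderEmbedding {Q : Type*} [PartialOrder Q] (hQ : IsNBowtieFree Q)
    (e : P ↪o Q) : IsNBowtieFree P :=
  ⟨⟨fun f => hQ.1.false (f.trans e)⟩, ⟨fun f => hQ.2.false (f.trans e)⟩⟩

theorem IsNBowtieFree.subtype (hP : IsNBowtieFree P) (p : P → Prop) :
    IsNBowtieFree {x // p x} :=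
  hP.of_orderEmbedding (OrderEmbedding.subtype p)

theorem IsNBowtieFree.dual (hP : IsNBowtieFree P) : IsNBowtieFree Pᵒᵈ :=
  ⟨⟨fun f => hP.1.false (PosetN.toDual.trans f.dual)⟩,
    ⟨fun f => hP.2.false (PosetBowtie.toDual.trans f.dual)⟩⟩

theorem IsNBowtieFree.eq_or_eq_of_zigzag (hP : IsNBowtieFree P) {a b c d : P} (ha : IsMin a)
    (hb : IsMax b) (hc : IsMin c) (hd : IsMax d) (hab : a ≤ b) (hcb : c ≤ b) (hcd : c ≤ d) :
    a = c ∨ b = d := by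
  by_contra! hne
  obtain ⟨hac, hbd⟩ := hne
  have nac : ¬a ≤ c := fun h => hac (hc.eq_of_le h)
  have nca : ¬c ≤ a := fun h => hac (ha.eq_of_le h).symm
  have nbd : ¬b ≤ d := fun h => hbd (hb.eq_of_ge h).symm
  have ndb : ¬d ≤ b := fun h => hbd (hd.eq_of_ge h)
  have nba : ¬b ≤ a := fun h => nca (hcb.trans h)
  have nbc : ¬b ≤ c := fun h => nac (hab.trans h)
  have ndc : ¬d ≤ c := fun h => ndb (h.trans hcb)
  have nda : ¬d ≤ a := fun h => ndb (h.trans hab)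
  by_cases had : a ≤ d
  · refine hP.2.false (OrderEmbedding.ofMapLEIff
      (fun x : PosetBowtie => match x with | .a => a | .b => b | .c => c | .d => d) ?_)
    intro x y; cases x <;> cases y <;> simp [PosetBowtie.le_iff, *]
  · refine hP.1.false (OrderEmbedding.ofMapLEIff
      (fun x : PosetN => match x with | .a => a | .b => b | .c => c | .d => d) ?_)
    intro x y; cases x <;> cases y <;> simp [PosetN.le_iff, *]

theorem exists_isMin_le [Finite P] (x : P) : ∃ a ≤ x, IsMin a := by
  obtain ⟨a, hax, ha⟩ := (Set.finite_univ (α := P)).exists_le_minimal (Set.mem_univ x)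
  exact ⟨a, hax, fun b hb => ha.2 (Set.mem_univ b) hb⟩

theorem exists_le_isMax [Finite P] (x : P) : ∃ b, x ≤ b ∧ IsMax b :=
  exists_isMin_le (P := Pᵒᵈ) x

/-- The poset has a least or a greatest element. -/
def HasBotOrTop (P : Type*) [LE P] : Prop :=
  (∃ a : P, IsBot a) ∨ ∃ b : P, IsTop b

theorem HasBotOrTop.nonempty (h : HasBotOrTop P) : Nonempty P :=
  h.elim (fun ⟨a, _⟩ => ⟨a⟩) fun ⟨b, _⟩ => ⟨b⟩

theorem HasBotOrTop.of_orderIso {Q : Type*} [PartialOrder Q] (h : HasBotOrTop P) (e : P ≃o Q) :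
    HasBotOrTop Q :=
  h.imp (fun ⟨a, ha⟩ => ⟨e a, fun _ => e.le_symm_apply.1 (ha _)⟩)
    fun ⟨b, hb⟩ => ⟨e b, fun _ => e.symm_apply_le.1 (hb _)⟩

/-- The subset is closed upwards and downwards and has a least or a greatest element. These
conditions make it a connected component of the comparability graph. -/
structure IsExtremalComponent (S : Set P) : Prop where
  isLowerSet : IsLowerSet S
  isUpperSet : IsUpperSet S
  hasBotOrTop : HasBotOrTop S

theorem IsNBowtieFree.exists_isExtremalComponent [Finite P] [Nonempty P] (hP : IsNBowtieFree P) :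
    ∃ S : Set P, IsExtremalComponent S := by
  obtain ⟨a, -, ha⟩ := exists_isMin_le (Classical.arbitrary P)
  by_cases hmax : ∃ b d, IsMax b ∧ IsMax d ∧ a ≤ b ∧ a ≤ d ∧ b ≠ d
  · obtain ⟨b, d, hb, hd, hab, had, hbd⟩ := hmax
    refine ⟨Set.Ici a, fun x y hyx hax => ?_, isUpperSet_Ici a,
      Or.inl ⟨⟨a, le_rfl⟩, fun x => x.2⟩⟩
    obtain ⟨a', hay, ha'⟩ := exists_isMin_le y
    obtain ⟨b', hxb, hb'⟩ := exists_le_isMax x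
    obtain ⟨d', hd', had', hne⟩ : ∃ d', IsMax d' ∧ a ≤ d' ∧ b' ≠ d' := by
      by_cases hb'b : b' = b
      · exact ⟨d, hd, had, hb'b ▸ hbd⟩
      · exact ⟨b, hb, hab, hb'b⟩
    exact (hP.eq_or_eq_of_zigzag ha' hb' ha hd' (hay.trans (hyx.trans hxb)) (le_trans hax hxb)
      had').elim (fun h => h ▸ hay) fun h => absurd h hne
  · obtain ⟨b, hab, hb⟩ := exists_le_isMax a
    refine ⟨Set.Iic b, isLowerSet_Iic b, fun x y hxy hxb => ?_,
      Or.inr ⟨⟨b, le_rfl⟩, fun x => x.2⟩⟩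
    obtain ⟨a', hax, ha'⟩ := exists_isMin_le x
    obtain ⟨b', hyb, hb'⟩ := exists_le_isMax y
    rcases hP.eq_or_eq_of_zigzag ha hb ha' hb' hab (hax.trans hxb) (hax.trans (hxy.trans hyb))
      with rfl | rfl
    · by_contra hyb'
      exact hmax ⟨b, b', hb, hb', hab, hax.trans (hxy.trans hyb), fun h => hyb' (h ▸ hyb)⟩
    · exact hyb

open scoped Classical in
/-- A subset that is closed upwards and downwards splits off as a summand. -/
noncomputable def sumComplOrderIso {S : Set P} (hl : IsLowerSet S) (hu : IsUpperSet S) :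
    (S ⊕ (Sᶜ : Set P)) ≃o P where
  __ := Equiv.Set.sumCompl S
  map_rel_iff' := by
    rintro (⟨x, hx⟩ | ⟨x, hx⟩) (⟨y, hy⟩ | ⟨y, hy⟩)
    · simp
    · simpa using fun hxy => hy (hu hxy hx)
    · simpa using fun hxy => hx (hl hxy hy)
    · simp

theorem IsExtremalComponent.exists_orderIso_of_subset {S : Set P} (hl : IsLowerSet S)
    (hu : IsUpperSet S) {T : Set S} (hT : IsExtremalComponent T) :
    ∃ T' : Set P, IsExtremalComponent T' ∧ Nonempty (T ≃o T') := by
  let e : T ≃o (Subtype.val '' T : Set P) :=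
    { toEquiv := Equiv.Set.image _ T Subtype.val_injective
      map_rel_iff' := Iff.rfl }
  refine ⟨_, ⟨?_, ?_, hT.hasBotOrTop.of_orderIso e⟩, ⟨e⟩⟩
  · rintro _ y hyx ⟨x, hx, rfl⟩
    exact ⟨⟨y, hl hyx x.2⟩, hT.isLowerSet hyx hx, rfl⟩
  · rintro _ y hxy ⟨x, hx, rfl⟩
    exact ⟨⟨y, hu hxy x.2⟩, hT.isUpperSet hxy hx, rfl⟩

theorem exists_withBot_orderIso {a : P} (ha : IsBot a) :
    Nonempty (WithBot {x : P // x ≠ a} ≃o P) := by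
  classical
  let _ : OrderBot P := { bot := a, bot_le := ha }
  exact ⟨WithBot.subtypeOrderIso⟩

theorem card_withBot (K : Type*) [Fintype K] : Fintype.card (WithBot K) = Fintype.card K + 1 :=
  (Fintype.card_congr (β := Option K) (Equiv.refl _)).trans Fintype.card_option

end Structure

section StrictPoly

open MvPolynomial

variable {P Q : Type*} [Fintype P] [Fintype Q]

theorem degree_content {Λ : Type*} (f : P → Λ) : (content f).degree = Fintype.card P := by
  simp [content, Finsupp.degree_single]

theorem one_lt_content_apply {Λ : Type*} {f : P → Λ} {u v : P} (huv : u ≠ v) (h : f u = f v) :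
    1 < content f (f u) := by
  classical
  have hcard : content f (f u) = (Finset.univ.filter (f · = f u)).card := by
    simp [content, Finsupp.finsetSum_apply, Finsupp.single_apply]
  rw [hcard]
  exact Finset.one_lt_card.2 ⟨u, by simp, v, by simp [h], huv⟩

theorem content_withBot {Λ : Type*} (f : WithBot P → Λ) :
    content f = Finsupp.single (f ⊥) 1 + content fun v : P => f v :=
  Fintype.sum_option fun v : Option P => Finsupp.single (f v) 1

theorem apply_bot_eq_zero_of_strictMono [PartialOrder P] [OrderBot P] {m : ℕ} {f : P → Fin (m + 1)}
    (hf : StrictMono f) (h0 : content f 0 ≠ 0) : f ⊥ = 0 := by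
  obtain ⟨v, hv⟩ := content_apply_ne_zero.1 h0
  exact Fin.le_zero_iff.1 (hv ▸ hf.monotone bot_le)

theorem cons_zero_eq_mapDomain_succ {m : ℕ} (d : Fin m →₀ ℕ) :
    d.cons 0 = d.mapDomain Fin.succ := by
  ext i
  induction i using Fin.cases with
  | zero => simp [Finsupp.mapDomain_of_notMem_range]
  | succ i => simp [Finsupp.mapDomain_apply (Fin.succ_injective m)]

theorem cons_eq_single_zero_add {m : ℕ} (n : ℕ) (d : Fin m →₀ ℕ) :
    d.cons n = Finsupp.single 0 n + d.mapDomain Fin.succ := by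
  rw [← cons_zero_eq_mapDomain_succ]
  ext i
  induction i using Fin.cases <;> simp [Fin.succ_ne_zero]

variable [PartialOrder P] [PartialOrder Q]

theorem admissibleCount_cons_zero {m : ℕ} (d : Fin m →₀ ℕ) :
    admissibleCount P Set.univ (d.cons 0) = admissibleCount P Set.univ d := by
  rw [cons_zero_eq_mapDomain_succ]
  exact admissibleCount_mapDomain (Fin.succOrderEmb m) Set.univ d

theorem admissibleCount_withBot_cons_one {m : ℕ} (d : Fin m →₀ ℕ) :
    admissibleCount (WithBot P) Set.univ (d.cons 1) = admissibleCount P Set.univ d := by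
  have hbot {f : WithBot P → Fin (m + 1)} (hf : IsAdmissible Set.univ f ∧ content f = d.cons 1) :
      f ⊥ = 0 :=
    apply_bot_eq_zero_of_strictMono (isAdmissible_univ_iff.1 hf.1) (by simp [hf.2])
  rw [← admissibleCount_cons_zero (P := P) d, cons_zero_eq_mapDomain_succ]
  rw [cons_eq_single_zero_add] at hbot ⊢
  refine Set.ncard_congr (fun f _ v => f v) (fun f hf => ⟨fun u v huv => ?_, ?_⟩)
    (fun f g hf hg hfg => ?_) fun g hg => ?_
  · exact hf.1 _ _ (WithBot.coe_lt_coe.2 huv)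
  · have hc := hf.2
    rwa [content_withBot, hbot hf, add_right_inj] at hc
  · ext v : 1
    induction v with
    | bot => rw [hbot hf, hbot hg]
    | coe v => exact congrFun hfg v
  · have hpos (v : P) : 0 < g v := by
      refine Fin.pos_of_ne_zero fun hv => content_apply_ne_zero.2 ⟨v, hv⟩ ?_
      rw [hg.2, Finsupp.mapDomain_of_notMem_range _ _ (by simp)]
    have hmono : StrictMono (WithBot.recBotCoe 0 g : WithBot P → Fin (m + 1)) :=
      WithBot.strictMono_iff.2 ⟨isAdmissible_univ_iff.1 hg.1, hpos⟩
    refine ⟨_, ⟨isAdmissible_univ_iff.2 hmono, ?_⟩, rfl⟩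
    rw [content_withBot]
    exact congrArg _ hg.2

theorem admissibleCount_withBot_cons_of_one_lt {m : ℕ} {n : ℕ} (hn : 1 < n) (d : Fin m →₀ ℕ) :
    admissibleCount (WithBot P) Set.univ (d.cons n) = 0 := by
  refine (Set.ncard_eq_zero ((finite_setOf_content_eq _).subset fun f hf => hf.2)).2 ?_
  refine Set.eq_empty_of_forall_notMem fun f hf => ?_
  have hn0 : content f 0 = n := by simp [hf.2]
  have hcoe : content (fun v : P => f v) 0 = 0 := by
    by_contra h
    obtain ⟨v, hv⟩ := content_apply_ne_zero.1 h
    exact Fin.not_lt_zero _ (hv ▸ isAdmissible_univ_iff.1 hf.1 (WithBot.bot_lt_coe v))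
  have hle : Finsupp.single (f ⊥) 1 (0 : Fin (m + 1)) ≤ 1 := by
    rw [Finsupp.single_apply]
    split_ifs <;> simp
  rw [content_withBot, Finsupp.add_apply, hcoe] at hn0
  omega

open scoped Classical in
/-- The strict order quasisymmetric function of `P` in `m` variables, as a polynomial. -/
noncomputable def strictPoly (m : ℕ) (P : Type*) [Fintype P] [PartialOrder P] :
    MvPolynomial (Fin m) ℤ :=
  ∑ f : P → Fin m with StrictMono f, ∏ v, X (f v)

theorem coeff_strictPoly {m : ℕ} (d : Fin m →₀ ℕ) :
    (strictPoly m P).coeff d = admissibleCount P Set.univ d := by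
  classical
  simp only [strictPoly, prod_X_eq_monomial_content, coeff_sum, coeff_monomial, Finset.sum_boole,
    Finset.filter_filter, admissibleCount, isAdmissible_univ_iff]
  rw [← Set.ncard_coe_finset]
  simp

theorem strictPoly_congr (e : P ≃o Q) (m : ℕ) : strictPoly m P = strictPoly m Q := by
  ext d
  rw [coeff_strictPoly, coeff_strictPoly, admissibleCount_congr e]

theorem strictPoly_eq_of_strictOrderQSym_eq (h : strictOrderQSym P = strictOrderQSym Q) (m : ℕ) :
    strictPoly m P = strictPoly m Q := by
  let e : Fin m ↪o ℕ+ := OrderEmbedding.ofStrictMono (fun i => Nat.succPNat i) fun i j hij =>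
    Nat.succPNat_strictMono hij
  ext d
  have hd := congrArg (MvPowerSeries.coeff (d.mapDomain e)) h
  rwa [coeff_strictOrderQSym, coeff_strictOrderQSym, admissibleCount_mapDomain,
    admissibleCount_mapDomain, Set.preimage_univ, ← coeff_strictPoly, ← coeff_strictPoly] at hd

theorem coeff_zero_finSuccEquiv_strictPoly (m : ℕ) :
    (finSuccEquiv ℤ m (strictPoly (m + 1) P)).coeff 0 = strictPoly m P := by
  ext d
  rw [finSuccEquiv_coeff_coeff, coeff_strictPoly, coeff_strictPoly, admissibleCount_cons_zero]

theorem finSuccEquiv_strictPoly_withBot (m : ℕ) :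
    finSuccEquiv ℤ m (strictPoly (m + 1) (WithBot P)) =
      Polynomial.C (strictPoly m P) * Polynomial.X + Polynomial.C (strictPoly m (WithBot P)) := by
  ext n d
  rw [Polynomial.coeff_add, Polynomial.coeff_C_mul_X, Polynomial.coeff_C]
  rcases n with _ | _ | n
  · simp [coeff_zero_finSuccEquiv_strictPoly]
  · simp [finSuccEquiv_coeff_coeff, coeff_strictPoly, admissibleCount_withBot_cons_one]
  · simp [finSuccEquiv_coeff_coeff, coeff_strictPoly, admissibleCount_withBot_cons_of_one_lt]

theorem strictMono_sum_iff {α β γ : Type*} [Preorder α] [Preorder β] [Preorder γ]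
    {f : α ⊕ β → γ} : StrictMono f ↔ StrictMono (f ∘ Sum.inl) ∧ StrictMono (f ∘ Sum.inr) := by
  simp [StrictMono]

theorem strictPoly_sum (m : ℕ) : strictPoly m (P ⊕ Q) = strictPoly m P * strictPoly m Q := by
  classical
  rw [strictPoly, strictPoly, strictPoly, Finset.sum_mul_sum, ← Finset.sum_product']
  refine Finset.sum_equiv (Equiv.sumArrowEquivProdArrow P Q (Fin m))
    (fun f => ?_) fun f _ => Fintype.prod_sum_type _
  simp only [Finset.mem_product, Finset.mem_filter, Finset.mem_univ, true_and]
  exact strictMono_sum_iff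

theorem strictPoly_dual (m : ℕ) : strictPoly m Pᵒᵈ = rename Fin.rev (strictPoly m P) := by
  classical
  rw [strictPoly, strictPoly, map_sum]
  refine Finset.sum_equiv (OrderDual.ofDual.arrowCongr Fin.revPerm) (fun f => ?_) fun f _ => ?_
  · rw [Finset.mem_filter_univ, Finset.mem_filter_univ]
    exact ⟨fun hf a b hab => Fin.rev_lt_rev.2 (hf (OrderDual.toDual_lt_toDual.2 hab)),
      fun hf a b hab => Fin.rev_lt_rev.1 (hf (OrderDual.ofDual_lt_ofDual.2 hab))⟩
  · rw [map_prod]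
    exact Fintype.prod_equiv OrderDual.ofDual _ _ fun v => by simp

theorem strictPoly_of_isEmpty [IsEmpty P] (m : ℕ) : strictPoly m P = 1 := by
  classical
  simp [strictPoly, StrictMono]

theorem isHomogeneous_strictPoly (m : ℕ) : (strictPoly m P).IsHomogeneous (Fintype.card P) := by
  refine IsHomogeneous.sum _ _ _ fun f _ => ?_
  rw [prod_X_eq_monomial_content]
  exact isHomogeneous_monomial _ (degree_content f)

theorem exists_strictMono_fin_isMin_eq_zero {m : ℕ} (h : Fintype.card P ≤ m) :
    ∃ f : P → Fin m, StrictMono f ∧ ∀ v, IsMin v → (f v : ℕ) = 0 := by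
  classical
  have hlt (v : P) : (Finset.univ.filter (· < v)).card < m :=
    (Finset.card_lt_univ_of_notMem (x := v) (by simp)).trans_le h
  refine ⟨fun v => ⟨_, hlt v⟩, fun a b hab => Fin.mk_lt_mk.2 ?_, fun v hv => ?_⟩
  · refine Finset.card_lt_card (Finset.ssubset_iff_of_subset ?_ |>.2 ⟨a, by simpa, by simp⟩)
    exact Finset.monotone_filter_right _ fun x _ hxa => hxa.trans hab
  · simpa [Finset.filter_eq_empty_iff] using fun x => hv.not_lt

theorem eval_one_strictPoly_pos {m : ℕ} (h : Fintype.card P ≤ m) :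
    0 < eval 1 (strictPoly m P) := by
  classical
  obtain ⟨f, hf, -⟩ := exists_strictMono_fin_isMin_eq_zero h
  rw [strictPoly, map_sum, Finset.sum_congr rfl fun f _ => show eval 1 (∏ v, X (f v)) = (1 : ℤ) by
    simp, Finset.sum_const, nsmul_one, Nat.cast_pos, Finset.card_pos]
  exact ⟨f, Finset.mem_filter.2 ⟨Finset.mem_univ f, hf⟩⟩

theorem strictPoly_ne_zero {m : ℕ} (h : Fintype.card P ≤ m) : strictPoly m P ≠ 0 := fun h0 => by
  simpa [h0] using eval_one_strictPoly_pos h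

theorem totalDegree_strictPoly {m : ℕ} (h : Fintype.card P ≤ m) :
    (strictPoly m P).totalDegree = Fintype.card P :=
  (isHomogeneous_strictPoly m).totalDegree (strictPoly_ne_zero h)

theorem card_eq_of_strictPoly_eq {m : ℕ} (h : Fintype.card P ≤ m)
    (heq : strictPoly m P = strictPoly m Q) : Fintype.card P = Fintype.card Q :=
  (isHomogeneous_strictPoly m).inj_right (heq ▸ isHomogeneous_strictPoly m) (strictPoly_ne_zero h)

theorem content_zero_le_natDegree_finSuccEquiv_strictPoly {m : ℕ} {f : P → Fin (m + 1)}
    (hf : StrictMono f) :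
    content f 0 ≤ (finSuccEquiv ℤ m (strictPoly (m + 1) P)).natDegree := by
  rw [natDegree_finSuccEquiv]
  refine monomial_le_degreeOf 0 (mem_support_iff.2 ?_)
  rw [coeff_strictPoly]
  exact Nat.cast_ne_zero.2 (Set.ncard_ne_zero_of_mem (a := f)
    ⟨isAdmissible_univ_iff.2 hf, rfl⟩ ((finite_setOf_content_eq _).subset fun g hg => hg.2))

theorem natDegree_finSuccEquiv_strictPoly_ne_zero [Nonempty P] {m : ℕ}
    (h : Fintype.card P ≤ m + 1) :
    (finSuccEquiv ℤ m (strictPoly (m + 1) P)).natDegree ≠ 0 := by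
  obtain ⟨f, hf, hmin⟩ := exists_strictMono_fin_isMin_eq_zero h
  obtain ⟨a, -, ha⟩ := exists_isMin_le (Classical.arbitrary P)
  have hcontent : content f 0 ≠ 0 := content_apply_ne_zero.2 ⟨a, Fin.ext (hmin a ha)⟩
  have hle := content_zero_le_natDegree_finSuccEquiv_strictPoly hf
  lia

theorem exists_isBot_of_natDegree_le_one [Nonempty P] {m : ℕ} (h : Fintype.card P ≤ m + 1)
    (hdeg : (finSuccEquiv ℤ m (strictPoly (m + 1) P)).natDegree ≤ 1) : ∃ a : P, IsBot a := by
  obtain ⟨f, hf, hmin⟩ := exists_strictMono_fin_isMin_eq_zero h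
  obtain ⟨a, -, ha⟩ := exists_isMin_le (Classical.arbitrary P)
  refine ⟨a, fun x => ?_⟩
  obtain ⟨b, hbx, hb⟩ := exists_isMin_le x
  suffices hab : a = b from hab ▸ hbx
  by_contra hab
  have ha0 : f a = 0 := Fin.ext (hmin a ha)
  have hcontent : 1 < content f 0 :=
    ha0 ▸ one_lt_content_apply hab (ha0.trans (Fin.ext (hmin b hb)).symm)
  have hle := content_zero_le_natDegree_finSuccEquiv_strictPoly hf
  lia

end StrictPoly

section Factorization

open MvPolynomial

variable {P : Type*} [Fintype P] [PartialOrder P]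

theorem isUnit_of_isPrimitive_of_natDegree_eq_zero {R : Type*} [CommRing R] {f : Polynomial R}
    (hf : f.IsPrimitive) (hdeg : f.natDegree = 0) : IsUnit f := by
  rw [Polynomial.eq_C_of_natDegree_eq_zero hdeg]
  exact (hf _ (Polynomial.eq_C_of_natDegree_eq_zero hdeg).symm.dvd).map Polynomial.C

theorem isUnit_or_natDegree_eq_zero_of_natDegree_mul_le_one {R : Type*} [CommRing R] [IsDomain R]
    {f g : Polynomial R} (hf : f.IsPrimitive) (h0 : f * g ≠ 0) (hdeg : (f * g).natDegree ≤ 1) :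
    IsUnit f ∨ g.natDegree = 0 := by
  rw [Polynomial.natDegree_mul (left_ne_zero_of_mul h0) (right_ne_zero_of_mul h0)] at hdeg
  refine or_iff_not_imp_left.2 fun hfu => ?_
  have := mt (isUnit_of_isPrimitive_of_natDegree_eq_zero hf) hfu
  lia

theorem isPrimitive_finSuccEquiv_mul {m : ℕ} {p q : MvPolynomial (Fin (m + 1)) ℤ}
    (hp : (finSuccEquiv ℤ m p).IsPrimitive) (hq : (finSuccEquiv ℤ m q).IsPrimitive) :
    (finSuccEquiv ℤ m (p * q)).IsPrimitive := by
  let _ : NormalizedGCDMonoid (MvPolynomial (Fin m) ℤ) :=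
    Classical.choice inferInstance
  rw [map_mul]
  exact hp.mul hq

theorem isPrimitive_finSuccEquiv_of_irreducible {m : ℕ} {p : MvPolynomial (Fin (m + 1)) ℤ}
    (hp : Irreducible p) (hdeg : (finSuccEquiv ℤ m p).natDegree ≠ 0) :
    (finSuccEquiv ℤ m p).IsPrimitive :=
  ((MulEquiv.irreducible_iff (finSuccEquiv ℤ m)).2 hp).isPrimitive hdeg

theorem natDegree_finSuccEquiv_strictPoly_withBot_le (m : ℕ) :
    (finSuccEquiv ℤ m (strictPoly (m + 1) (WithBot P))).natDegree ≤ 1 := by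
  rw [finSuccEquiv_strictPoly_withBot]
  exact Polynomial.natDegree_linear_le

theorem mul_dvd_of_isPrimitive_finSuccEquiv {m : ℕ} {f g p : MvPolynomial (Fin (m + 1)) ℤ}
    (hp : (finSuccEquiv ℤ m p).IsPrimitive) (hf : f ∣ p) (hg : g ∣ p) (h0 : f * g ≠ 0)
    (hdeg : (finSuccEquiv ℤ m (f * g)).natDegree ≤ 1) : f * g ∣ p := by
  have hf' := Polynomial.isPrimitive_of_dvd hp (map_dvd _ hf)
  have hg' := Polynomial.isPrimitive_of_dvd hp (map_dvd _ hg)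
  rw [← EmbeddingLike.map_ne_zero_iff (f := finSuccEquiv ℤ m), map_mul] at h0
  rw [map_mul] at hdeg
  rcases isUnit_or_natDegree_eq_zero_of_natDegree_mul_le_one hf' h0 hdeg with hu | hg0
  · rwa [((MulEquiv.isUnit_map (finSuccEquiv ℤ m)).1 hu).mul_left_dvd]
  · have hu := isUnit_of_isPrimitive_of_natDegree_eq_zero hg' hg0
    rwa [((MulEquiv.isUnit_map (finSuccEquiv ℤ m)).1 hu).mul_right_dvd]

theorem not_strictPoly_withBot_dvd {m : ℕ} (h : Fintype.card P < m) :
    ¬strictPoly m (WithBot P) ∣ strictPoly m P := by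
  intro hdvd
  have hcard := card_withBot P
  have hle := totalDegree_le_of_dvd_of_isDomain hdvd (strictPoly_ne_zero h.le)
  rw [totalDegree_strictPoly (by lia), totalDegree_strictPoly h.le] at hle
  lia

theorem isRelPrime_strictPoly_withBot {m : ℕ} (hm : Fintype.card P ≤ m)
    (h₁ : (finSuccEquiv ℤ m (strictPoly (m + 1) P)).IsPrimitive)
    (h₂ : (finSuccEquiv ℤ (m + 1) (strictPoly (m + 2) P)).IsPrimitive) :
    IsRelPrime (strictPoly (m + 2) P) (strictPoly (m + 2) (WithBot P)) := by
  rintro f hfP ⟨g, hfg⟩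
  have hcard := card_withBot P
  have hmap : finSuccEquiv ℤ (m + 1) f * finSuccEquiv ℤ (m + 1) g =
      Polynomial.C (strictPoly (m + 1) P) * Polynomial.X +
        Polynomial.C (strictPoly (m + 1) (WithBot P)) := by
    rw [← map_mul, ← hfg, finSuccEquiv_strictPoly_withBot]
  have hne : finSuccEquiv ℤ (m + 1) f * finSuccEquiv ℤ (m + 1) g ≠ 0 := by
    rw [← map_mul, ← hfg]
    exact EmbeddingLike.map_ne_zero_iff.2 (strictPoly_ne_zero (by lia))
  rcases isUnit_or_natDegree_eq_zero_of_natDegree_mul_le_one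
    (Polynomial.isPrimitive_of_dvd h₂ (map_dvd _ hfP)) hne
    (hmap ▸ Polynomial.natDegree_linear_le) with hu | hg
  · exact (MulEquiv.isUnit_map (finSuccEquiv ℤ (m + 1))).1 hu
  exfalso
  obtain ⟨q, hq⟩ : ∃ q, finSuccEquiv ℤ (m + 1) g = Polynomial.C q :=
    ⟨_, Polynomial.eq_C_of_natDegree_eq_zero hg⟩
  rw [hq] at hmap
  have hqP : q ∣ strictPoly (m + 1) P :=
    Dvd.intro_left _ (by simpa using congrArg (Polynomial.coeff · 1) hmap)
  have hfq : (finSuccEquiv ℤ (m + 1) f).coeff 0 * q = strictPoly (m + 1) (WithBot P) := by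
    simpa using congrArg (Polynomial.coeff · 0) hmap
  have hfP₀ : (finSuccEquiv ℤ (m + 1) f).coeff 0 ∣ strictPoly (m + 1) P := by
    obtain ⟨r, hr⟩ := hfP
    rw [← coeff_zero_finSuccEquiv_strictPoly, hr, map_mul, Polynomial.mul_coeff_zero]
    exact dvd_mul_right _ _
  refine not_strictPoly_withBot_dvd (Nat.lt_succ_of_le hm) (hfq ▸ ?_)
  refine mul_dvd_of_isPrimitive_finSuccEquiv h₁ hfP₀ hqP ?_ ?_
  · exact hfq ▸ strictPoly_ne_zero (by lia)
  · exact hfq ▸ natDegree_finSuccEquiv_strictPoly_withBot_le m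

theorem irreducible_strictPoly_withBot {m : ℕ} (hm : Fintype.card P ≤ m)
    (h₁ : (finSuccEquiv ℤ m (strictPoly (m + 1) P)).IsPrimitive)
    (h₂ : (finSuccEquiv ℤ (m + 1) (strictPoly (m + 2) P)).IsPrimitive) :
    Irreducible (strictPoly (m + 3) (WithBot P)) := by
  rw [← MulEquiv.irreducible_iff (finSuccEquiv ℤ (m + 2)), finSuccEquiv_strictPoly_withBot]
  exact Polynomial.irreducible_C_mul_X_add_C (strictPoly_ne_zero (by lia))
    (isRelPrime_strictPoly_withBot hm h₁ h₂)

theorem irreducible_strictPoly_dual_iff {m : ℕ} :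
    Irreducible (strictPoly m Pᵒᵈ) ↔ Irreducible (strictPoly m P) := by
  rw [strictPoly_dual]
  exact MulEquiv.irreducible_iff (renameEquiv ℤ Fin.revPerm)

theorem eq_of_associated_of_eval_pos {σ : Type*} {p q : MvPolynomial σ ℤ} {x : σ → ℤ}
    (h : Associated p q) (hp : 0 < eval x p) (hq : 0 < eval x q) : p = q := by
  obtain ⟨u, rfl⟩ := h
  obtain ⟨r, hr, hu⟩ := isUnit_iff_eq_C_of_isReduced.1 u.isUnit
  rw [hu] at hq ⊢
  rcases Int.isUnit_iff.1 hr with rfl | rfl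
  · simp
  · simp only [map_mul, eval_C] at hq
    lia

end Factorization

section Components

open MvPolynomial

universe u

open scoped Classical in
theorem strictPoly_mul_compl {P : Type*} [Fintype P] [PartialOrder P] {S : Set P}
    (hl : IsLowerSet S) (hu : IsUpperSet S) (m : ℕ) :
    strictPoly m S * strictPoly m (Sᶜ : Set P) = strictPoly m P := by
  rw [← strictPoly_sum, strictPoly_congr (sumComplOrderIso hl hu)]

open scoped Classical in
theorem card_subtype_ne_add_one {P : Type*} [Fintype P] (a : P) :
    Fintype.card {x : P // x ≠ a} + 1 = Fintype.card P := by
  rw [Fintype.card_subtype_compl, Fintype.card_subtype_eq]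
  exact Nat.sub_add_cancel (Fintype.card_pos_iff.2 ⟨a⟩)

open scoped Classical in
theorem IsExtremalComponent.card_compl_lt {P : Type*} [Fintype P] [PartialOrder P] {S : Set P}
    (hS : IsExtremalComponent S) : Fintype.card (Sᶜ : Set P) < Fintype.card P := by
  obtain ⟨x⟩ := hS.hasBotOrTop.nonempty
  exact Fintype.card_subtype_lt (x := (x : P)) (by simp)

open scoped Classical in
theorem irreducible_strictPoly_of_isBot {T : Type*} [Fintype T] [PartialOrder T] {a : T}
    (ha : IsBot a) {n : ℕ} (hn : 2 * Fintype.card T < n)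
    (h : ∀ m, 2 * Fintype.card {x : T // x ≠ a} ≤ m →
      (finSuccEquiv ℤ m (strictPoly (m + 1) {x : T // x ≠ a})).IsPrimitive) :
    Irreducible (strictPoly n T) := by
  have hcard := card_subtype_ne_add_one a
  obtain ⟨m, rfl⟩ : ∃ m, n = m + 3 := Nat.exists_eq_add_of_le' (by lia)
  obtain ⟨e⟩ := exists_withBot_orderIso ha
  rw [← strictPoly_congr e]
  exact irreducible_strictPoly_withBot (by lia) (h m (by lia)) (h (m + 1) (by lia))

theorem irreducible_strictPoly_of_hasBotOrTop {T : Type u} [Fintype T] [PartialOrder T]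
    (hT : IsNBowtieFree T) (hext : HasBotOrTop T) {n : ℕ} (hn : 2 * Fintype.card T < n)
    (h : ∀ (K : Type u) [Fintype K] [PartialOrder K], IsNBowtieFree K →
      Fintype.card K < Fintype.card T → ∀ m, 2 * Fintype.card K ≤ m →
      (finSuccEquiv ℤ m (strictPoly (m + 1) K)).IsPrimitive) :
    Irreducible (strictPoly n T) := by
  classical
  rcases hext with ⟨a, ha⟩ | ⟨b, hb⟩
  · have hcard := card_subtype_ne_add_one a
    exact irreducible_strictPoly_of_isBot ha hn (h _ (hT.subtype _) (by lia))
  · have hcard := card_subtype_ne_add_one (OrderDual.toDual b)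
    rw [Fintype.card_orderDual] at hcard
    rw [← irreducible_strictPoly_dual_iff]
    exact irreducible_strictPoly_of_isBot hb.toDual (by rwa [Fintype.card_orderDual])
      (h _ (hT.dual.subtype _) (by lia))

theorem IsNBowtieFree.isPrimitive_finSuccEquiv_strictPoly {P : Type u} [Fintype P]
    [PartialOrder P] (hP : IsNBowtieFree P) {m : ℕ} (hm : 2 * Fintype.card P ≤ m) :
    (finSuccEquiv ℤ m (strictPoly (m + 1) P)).IsPrimitive := by
  classical
  induction hn : Fintype.card P using Nat.strong_induction_on generalizing P m with
  | _ n ih =>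
  cases isEmpty_or_nonempty P with
  | inl hempty => simp [strictPoly_of_isEmpty, Polynomial.isPrimitive_one]
  | inr hnonempty =>
    obtain ⟨S, hS⟩ := hP.exists_isExtremalComponent
    have hSle : Fintype.card S ≤ Fintype.card P := Fintype.card_subtype_le _
    have hSc := hS.card_compl_lt
    have := hS.hasBotOrTop.nonempty
    rw [← strictPoly_mul_compl hS.isLowerSet hS.isUpperSet]
    refine isPrimitive_finSuccEquiv_mul (isPrimitive_finSuccEquiv_of_irreducible ?_ ?_)
      (ih _ (by lia) (hP.subtype _) (by lia) rfl)
    · exact irreducible_strictPoly_of_hasBotOrTop (hP.subtype _) hS.hasBotOrTop (by lia)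
        fun K _ _ hK hKS k hk => ih _ (by lia) hK hk rfl
    · exact natDegree_finSuccEquiv_strictPoly_ne_zero (by lia)

theorem IsNBowtieFree.irreducible_strictPoly {P : Type*} [Fintype P] [PartialOrder P]
    (hP : IsNBowtieFree P) (hext : HasBotOrTop P) {m : ℕ} (hm : 2 * Fintype.card P < m) :
    Irreducible (strictPoly m P) :=
  irreducible_strictPoly_of_hasBotOrTop hP hext hm fun _ _ _ hK _ _ hk =>
    hK.isPrimitive_finSuccEquiv_strictPoly hk

open scoped Classical in
theorem IsNBowtieFree.exists_isExtremalComponent_dvd {Q : Type*} [Fintype Q] [PartialOrder Q]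
    (hQ : IsNBowtieFree Q) {m : ℕ} {p : MvPolynomial (Fin m) ℤ} (hp : Prime p)
    (hdvd : p ∣ strictPoly m Q) : ∃ S : Set Q, IsExtremalComponent S ∧ p ∣ strictPoly m S := by
  induction hn : Fintype.card Q using Nat.strong_induction_on generalizing Q with
  | _ n ih =>
  cases isEmpty_or_nonempty Q with
  | inl hempty => exact absurd (strictPoly_of_isEmpty (P := Q) m ▸ hdvd) hp.not_dvd_one
  | inr hnonempty =>
    obtain ⟨S, hS⟩ := hQ.exists_isExtremalComponent
    rw [← strictPoly_mul_compl hS.isLowerSet hS.isUpperSet] at hdvd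
    rcases hp.dvd_or_dvd hdvd with hpS | hpS
    · exact ⟨S, hS, hpS⟩
    · obtain ⟨T, hT, hpT⟩ := ih _ (hn ▸ hS.card_compl_lt) (hQ.subtype _) hpS rfl
      obtain ⟨T', hT', ⟨e⟩⟩ :=
        hT.exists_orderIso_of_subset hS.isUpperSet.compl hS.isLowerSet.compl
      exact ⟨T', hT', strictPoly_congr e m ▸ hpT⟩

theorem strictPoly_eq_of_dvd_of_irreducible {P Q : Type*} [Fintype P] [PartialOrder P] [Fintype Q]
    [PartialOrder Q] {m : ℕ} (hPm : Fintype.card P ≤ m) (hQm : Fintype.card Q ≤ m)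
    (hP : Irreducible (strictPoly m P)) (hQ : Irreducible (strictPoly m Q))
    (h : strictPoly m P ∣ strictPoly m Q) : strictPoly m P = strictPoly m Q :=
  eq_of_associated_of_eval_pos (hP.associated_of_dvd hQ h) (eval_one_strictPoly_pos hPm)
    (eval_one_strictPoly_pos hQm)

end Components

section Reconstruction

open MvPolynomial

universe u v

theorem strictPoly_eq_of_strictPoly_withBot_eq {P Q : Type*} [Fintype P] [PartialOrder P]
    [Fintype Q] [PartialOrder Q] {m : ℕ}
    (h : strictPoly (m + 1) (WithBot P) = strictPoly (m + 1) (WithBot Q)) :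
    strictPoly m P = strictPoly m Q := by
  simpa [finSuccEquiv_strictPoly_withBot] using
    congrArg (fun p => (finSuccEquiv ℤ m p).coeff 1) h

open scoped Classical in
theorem exists_isBot_of_strictPoly_eq {P Q : Type*} [Fintype P] [PartialOrder P] [Fintype Q]
    [PartialOrder Q] {m : ℕ} (hm : Fintype.card P ≤ m + 1) {a : P} (ha : IsBot a)
    (h : strictPoly (m + 1) P = strictPoly (m + 1) Q) : ∃ b : Q, IsBot b ∧
      strictPoly m {x : P // x ≠ a} = strictPoly m {x : Q // x ≠ b} := by
  obtain ⟨e⟩ := exists_withBot_orderIso ha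
  have hcard := card_eq_of_strictPoly_eq hm h
  have : Nonempty Q := Fintype.card_pos_iff.1 (hcard ▸ Fintype.card_pos_iff.2 ⟨a⟩)
  rw [← strictPoly_congr e] at h
  obtain ⟨b, hb⟩ := exists_isBot_of_natDegree_le_one (P := Q) (hcard ▸ hm)
    (h ▸ natDegree_finSuccEquiv_strictPoly_withBot_le m)
  obtain ⟨e'⟩ := exists_withBot_orderIso hb
  rw [← strictPoly_congr e'] at h
  exact ⟨b, hb, strictPoly_eq_of_strictPoly_withBot_eq h⟩

open scoped Classical in
theorem nonempty_orderIso_of_isBot {P Q : Type*} [Fintype P] [PartialOrder P] [Fintype Q]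
    [PartialOrder Q] {a : P} (ha : IsBot a) {m : ℕ} (hm : 2 * Fintype.card P < m)
    (h : strictPoly m P = strictPoly m Q)
    (ih : ∀ (b : Q) (k : ℕ), 2 * Fintype.card {x : P // x ≠ a} < k →
      strictPoly k {x : P // x ≠ a} = strictPoly k {x : Q // x ≠ b} →
      Nonempty ({x : P // x ≠ a} ≃o {x : Q // x ≠ b})) : Nonempty (P ≃o Q) := by
  have hcard := card_subtype_ne_add_one a
  obtain ⟨k, rfl⟩ : ∃ k, m = k + 1 := Nat.exists_eq_add_of_le' (by lia)
  obtain ⟨b, hb, hab⟩ := exists_isBot_of_strictPoly_eq (by lia) ha h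
  obtain ⟨eP⟩ := exists_withBot_orderIso ha
  obtain ⟨eQ⟩ := exists_withBot_orderIso hb
  obtain ⟨e⟩ := ih b k (by lia) hab
  exact ⟨eP.symm.trans (e.withBotCongr.trans eQ)⟩

theorem nonempty_orderIso_of_hasBotOrTop {P : Type u} {Q : Type v} [Fintype P] [PartialOrder P]
    [Fintype Q] [PartialOrder Q] (hP : IsNBowtieFree P) (hQ : IsNBowtieFree Q)
    (hext : HasBotOrTop P) {m : ℕ} (hm : 2 * Fintype.card P < m)
    (h : strictPoly m P = strictPoly m Q)
    (ih : ∀ (K : Type u) (L : Type v) [Fintype K] [PartialOrder K] [Fintype L] [PartialOrder L],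
      IsNBowtieFree K → IsNBowtieFree L → Fintype.card K < Fintype.card P →
      ∀ k, 2 * Fintype.card K < k → strictPoly k K = strictPoly k L → Nonempty (K ≃o L)) :
    Nonempty (P ≃o Q) := by
  classical
  rcases hext with ⟨a, ha⟩ | ⟨b, hb⟩
  · have hcard := card_subtype_ne_add_one a
    exact nonempty_orderIso_of_isBot ha hm h fun b =>
      ih _ _ (hP.subtype _) (hQ.subtype _) (by lia)
  · have hcard := card_subtype_ne_add_one (OrderDual.toDual b)
    rw [Fintype.card_orderDual] at hcard
    obtain ⟨e⟩ := nonempty_orderIso_of_isBot (P := Pᵒᵈ) (Q := Qᵒᵈ) hb.toDual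
      (by rwa [Fintype.card_orderDual]) (by rw [strictPoly_dual, strictPoly_dual, h])
      fun b => ih _ _ (hP.dual.subtype _) (hQ.dual.subtype _) (by lia)
    exact ⟨e.dual⟩

open scoped Classical in
theorem IsNBowtieFree.exists_isExtremalComponent_strictPoly_eq {P Q : Type*} [Fintype P]
    [PartialOrder P] [Fintype Q] [PartialOrder Q] (hP : IsNBowtieFree P) (hQ : IsNBowtieFree Q)
    {m : ℕ} (hm : 2 * Fintype.card P < m) (h : strictPoly m P = strictPoly m Q) {S : Set P}
    (hS : IsExtremalComponent S) : ∃ T : Set Q, IsExtremalComponent T ∧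
      strictPoly m S = strictPoly m T ∧
      strictPoly m (Sᶜ : Set P) = strictPoly m (Tᶜ : Set Q) := by
  have hcard := card_eq_of_strictPoly_eq (by lia) h
  have hSle : Fintype.card S ≤ Fintype.card P := Fintype.card_subtype_le _
  have hSirr := (hP.subtype _).irreducible_strictPoly hS.hasBotOrTop (m := m) (by lia)
  rw [← strictPoly_mul_compl hS.isLowerSet hS.isUpperSet] at h
  obtain ⟨T, hT, hdvd⟩ :=
    hQ.exists_isExtremalComponent_dvd hSirr.prime (h ▸ dvd_mul_right _ _)
  have hTle : Fintype.card T ≤ Fintype.card Q := Fintype.card_subtype_le _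
  have hST := strictPoly_eq_of_dvd_of_irreducible (by lia) (by lia) hSirr
    ((hQ.subtype _).irreducible_strictPoly hT.hasBotOrTop (by lia)) hdvd
  refine ⟨T, hT, hST, mul_left_cancel₀ hSirr.ne_zero ?_⟩
  rw [h, hST, strictPoly_mul_compl hT.isLowerSet hT.isUpperSet]

theorem IsNBowtieFree.nonempty_orderIso {P : Type u} {Q : Type v} [Fintype P] [PartialOrder P]
    [Fintype Q] [PartialOrder Q] (hP : IsNBowtieFree P) (hQ : IsNBowtieFree Q) {m : ℕ}
    (hm : 2 * Fintype.card P < m) (h : strictPoly m P = strictPoly m Q) : Nonempty (P ≃o Q) := by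
  classical
  induction hn : Fintype.card P using Nat.strong_induction_on generalizing P Q m with
  | _ n ih =>
  cases isEmpty_or_nonempty P with
  | inl hempty =>
    have : IsEmpty Q := Fintype.card_eq_zero_iff.1
      (card_eq_of_strictPoly_eq (by lia) h ▸ Fintype.card_eq_zero)
    exact ⟨OrderIso.ofIsEmpty P Q⟩
  | inr hnonempty =>
    obtain ⟨S, hS⟩ := hP.exists_isExtremalComponent
    obtain ⟨T, hT, hST, hSTc⟩ := hP.exists_isExtremalComponent_strictPoly_eq hQ hm h hS
    have hSle : Fintype.card S ≤ Fintype.card P := Fintype.card_subtype_le _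
    have hSc := hS.card_compl_lt
    obtain ⟨e⟩ : Nonempty (S ≃o T) :=
      nonempty_orderIso_of_hasBotOrTop (hP.subtype _) (hQ.subtype _) hS.hasBotOrTop (by lia) hST
        fun K L _ _ _ _ hK hL hKS k hk hKL => ih _ (by lia) hK hL hk hKL rfl
    obtain ⟨e'⟩ : Nonempty ((Sᶜ : Set P) ≃o (Tᶜ : Set Q)) :=
      ih _ (by lia) (hP.subtype _) (hQ.subtype _) (by lia) hSTc rfl
    exact ⟨(sumComplOrderIso hS.isLowerSet hS.isUpperSet).symm.trans ((e.sumCongr e').trans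
      (sumComplOrderIso hT.isLowerSet hT.isUpperSet))⟩

end Reconstruction

theorem weakOrderQSym_congr {P Q : Type*} [Fintype P] [PartialOrder P] [Fintype Q]
    [PartialOrder Q] (e : P ≃o Q) : weakOrderQSym P = weakOrderQSym Q := by
  ext d
  rw [coeff_weakOrderQSym, coeff_weakOrderQSym, admissibleCount_congr e]

theorem theorem5p1 {P : Type*} {Q : Type*} [Fintype P] [PartialOrder P] [Fintype Q]
    [PartialOrder Q] (hP : IsNBowtieFree P) (hQ : IsNBowtieFree Q) :
    List.TFAE
      [strictOrderQSym P = strictOrderQSym Q,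
       weakOrderQSym P = weakOrderQSym Q,
       Nonempty (P ≃o Q)] := by
  tfae_have 1 → 3 := fun h =>
    hP.nonempty_orderIso hQ (Nat.lt_succ_self _) (strictPoly_eq_of_strictOrderQSym_eq h _)
  tfae_have 3 → 2 := fun ⟨e⟩ => weakOrderQSym_congr e
  tfae_have 2 → 1 := strictOrderQSym_eq_of_weakOrderQSym_eq
  tfae_finish
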